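/- Let $\mathbb{K}$ be a field of characteristic $0$. Let $\mathcal{W}$ be the Witt algebra over $\mathbb{K}$, i.e. the Lie algebra with vector space basis $e_n$ ($n\in\mathbb{Z}$) and bracket $[e_n,e_m]=(m-n)e_{n+m}$, and let $\mathcal{V}=\mathbb{K}t\oplus\mathcal{W}$ be the Virasoro algebra, with central element $t$ and $[e_n,e_m]=(m-n)e_{n+m}-\frac{1}{12}(n^3-n)\delta_n^{-m}\,t$. Then both $L=\mathcal{W}$ and $L=\mathcal{V}$ are infinitesimally and formally rigid, that is: (a) Every infinitesimal deformation of $L$ is equivalent to the trivial one: for every $\mathbb{K}[\varepsilon]$-Lie algebra structure ($\varepsilon^2=0$) on $\mathbb{K}[\varepsilon]\otimes_{\mathbb{K}} L$ that reduces modulo $\varepsilon$ to the bracket of $L$, there is a $\mathbb{K}[\varepsilon]$-linear Lie algebra isomorphism, equal to the identity modulo $\varepsilon$, onto $\mathbb{K}[\varepsilon]\otimes_{\mathbb{K}} L$ with the $\mathbb{K}[\varepsilon]$-bilinear extension of the bracket of $L$. (b) Every formal one-parameter deformation of $L$ is equivalent to the trivial one: for every family of alternating $\mathbb{K}$-bilinear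 maps $\mu_n\colon L\times L\to L$ ($n\ge 0$) with $\mu_0=[\cdot,\cdot]$ such that the $\mathbb{K}[[t]]$-bilinear extension of $[x,y]_t=\sum_{n\ge 0}\mu_n(x,y)t^n$ to $L[[t]]$ satisfies the Jacobi identity (here $t$ is a formal parameter), there are $\mathbb{K}$-linear maps $\Phi_n\colon L\to L$ with $\Phi_0=\mathrm{id}$ such that $\Phi=\sum_{n\ge 0}\Phi_n t^n$ satisfies $\Phi([x,y]_t)=[\Phi(x),\Phi(y)]$ for all $x,y\in L$, where the bracket on the right is the $\mathbb{K}[[t]]$-bilinear extension of the bracket of $L$. -/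

import Mathlib

open scoped TensorProduct DualNumber

noncomputable section

/-! ### The Witt algebra -/

/-- The Witt algebra over `K`, as a vector space: it has a basis `e n`, `n ∈ ℤ`. -/
def WittAlgebra (K : Type*) [Field K] : Type _ := ℤ →₀ K

namespace WittAlgebra

instance {K : Type*} [Field K] : AddCommGroup (WittAlgebra K) :=
  inferInstanceAs (AddCommGroup (ℤ →₀ K))

instance {K : Type*} [Field K] : Module K (WittAlgebra K) :=
  inferInstanceAs (Module K (ℤ →₀ K))

/-- The standard basis, indexed by `ℤ`. -/
def basis (K : Type*) [Field K] : Module.Basis ℤ K (WittAlgebra K) :=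
  Module.Basis.ofRepr (LinearEquiv.refl K (ℤ →₀ K))

/-- The basis vector `e n`. -/
def e {K : Type*} [Field K] (n : ℤ) : WittAlgebra K := basis K n

theorem induction_e {K : Type*} [Field K] {p : WittAlgebra K → Prop} (x : WittAlgebra K)
    (h0 : p 0) (hadd : ∀ y z, p y → p z → p (y + z)) (hsmul : ∀ (c : K) y, p y → p (c • y))
    (he : ∀ n, p (e n)) : p x := by
  have hx : x ∈ Submodule.span K (Set.range (basis K)) := (basis K).mem_span x
  induction hx using Submodule.span_induction with
  | mem y hy => obtain ⟨n, rfl⟩ := hy; exact he n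
  | zero => exact h0
  | add y z _ _ hy hz => exact hadd y z hy hz
  | smul c y _ hy => exact hsmul c y hy

/-- The bilinear product determined by `[e n, e m] = (m - n) e (n + m)`. -/
def bracketMap (K : Type*) [Field K] :
    WittAlgebra K →ₗ[K] WittAlgebra K →ₗ[K] WittAlgebra K :=
  (basis K).constr K fun n => (basis K).constr K fun m => ((m : K) - (n : K)) • e (n + m)

theorem bracketMap_e {K : Type*} [Field K] (n m : ℤ) :
    bracketMap K (e n) (e m) = ((m : K) - (n : K)) • e (n + m) := by
  simp [bracketMap, e]

theorem bracketMap_swap {K : Type*} [Field K] (x y : WittAlgebra K) :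
    bracketMap K x y = -bracketMap K y x := by
  induction x using induction_e with
  | h0 => simp
  | hadd a b ha hb => simp only [map_add, LinearMap.add_apply, ha, hb]; abel
  | hsmul c a ha => simp [ha]
  | he n =>
    induction y using induction_e with
    | h0 => simp
    | hadd a b ha hb => simp only [map_add, LinearMap.add_apply, ha, hb]; abel
    | hsmul c a ha => simp [ha]
    | he m => rw [bracketMap_e, bracketMap_e, ← neg_smul, neg_sub, add_comm]

theorem bracketMap_self {K : Type*} [Field K] [CharZero K] (x : WittAlgebra K) :
    bracketMap K x x = 0 := by
  have h : (2 : K) • bracketMap K x x = 0 := by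
    rw [two_smul]; nth_rewrite 1 [bracketMap_swap]; exact neg_add_cancel _
  exact (smul_eq_zero.mp h).resolve_left two_ne_zero

theorem bracketMap_leibniz {K : Type*} [Field K] (x y z : WittAlgebra K) :
    bracketMap K x (bracketMap K y z) =
      bracketMap K (bracketMap K x y) z + bracketMap K y (bracketMap K x z) := by
  induction x using induction_e with
  | h0 => simp
  | hadd a b ha hb => simp only [map_add, LinearMap.add_apply, ha, hb]; abel
  | hsmul c a ha => simp [ha]
  | he n =>
    induction y using induction_e with
    | h0 => simp
    | hadd a b ha hb => simp only [map_add, LinearMap.add_apply, ha, hb]; abel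
    | hsmul c a ha => simp [ha]
    | he m =>
      induction z using induction_e with
      | h0 => simp
      | hadd a b ha hb => simp only [map_add, ha, hb]; abel
      | hsmul c a ha => simp [ha]
      | he k =>
        simp only [bracketMap_e, map_smul, LinearMap.smul_apply, smul_smul]
        rw [show n + m + k = n + (m + k) by ring, show m + (n + k) = n + (m + k) by ring,
          ← add_smul]
        congr 1
        push_cast
        ring

instance {K : Type*} [Field K] [CharZero K] : LieRing (WittAlgebra K) where
  bracket x y := bracketMap K x y
  add_lie x y z := by change bracketMap K (x + y) z = _; simp
  lie_add x y z := by change bracketMap K x (y + z) = _; simp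
  lie_self x := bracketMap_self x
  leibniz_lie x y z := bracketMap_leibniz x y z

instance {K : Type*} [Field K] [CharZero K] : LieAlgebra K (WittAlgebra K) where
  lie_smul c x y := (bracketMap K x).map_smul c y

theorem e_lie_e {K : Type*} [Field K] [CharZero K] (n m : ℤ) :
    ⁅(e n : WittAlgebra K), (e m : WittAlgebra K)⁆ = ((m : K) - (n : K)) • e (n + m) :=
  bracketMap_e n m

/-- The bilinear form with value `-(n ^ 3 - n) / 12` on `(e n, e (-n))`, and `0` on all other
pairs of basis vectors. -/
def centralForm (K : Type*) [Field K] : WittAlgebra K →ₗ[K] WittAlgebra K →ₗ[K] K :=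
  (basis K).constr K fun n => (basis K).constr K fun m =>
    if n = -m then -(1 / 12 * ((n : K) ^ 3 - (n : K))) else 0

theorem centralForm_e {K : Type*} [Field K] (n m : ℤ) :
    centralForm K (e n) (e m) = if n = -m then -(1 / 12 * ((n : K) ^ 3 - (n : K))) else 0 := by
  simp [centralForm, e]

theorem centralForm_swap {K : Type*} [Field K] (x y : WittAlgebra K) :
    centralForm K x y = -centralForm K y x := by
  induction x using induction_e with
  | h0 => simp
  | hadd a b ha hb => simp only [map_add, LinearMap.add_apply, ha, hb]; abel
  | hsmul c a ha => simp [ha]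
  | he n =>
    induction y using induction_e with
    | h0 => simp
    | hadd a b ha hb => simp only [map_add, LinearMap.add_apply, ha, hb]; abel
    | hsmul c a ha => simp [ha]
    | he m =>
      rw [centralForm_e, centralForm_e]
      by_cases h : n = -m
      · subst h
        simp
        ring
      · rw [if_neg h, if_neg (by omega), neg_zero]

theorem centralForm_self {K : Type*} [Field K] [CharZero K] (x : WittAlgebra K) :
    centralForm K x x = 0 :=
  self_eq_neg.mp (centralForm_swap x x)

theorem centralForm_leibniz {K : Type*} [Field K] (x y z : WittAlgebra K) :
    centralForm K x (bracketMap K y z) =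
      centralForm K (bracketMap K x y) z + centralForm K y (bracketMap K x z) := by
  induction x using induction_e with
  | h0 => simp
  | hadd a b ha hb => simp only [map_add, LinearMap.add_apply, ha, hb]; abel
  | hsmul c a ha => simp [ha, mul_add]
  | he n =>
    induction y using induction_e with
    | h0 => simp
    | hadd a b ha hb => simp only [map_add, LinearMap.add_apply, ha, hb]; abel
    | hsmul c a ha => simp [ha, mul_add]
    | he m =>
      induction z using induction_e with
      | h0 => simp
      | hadd a b ha hb => simp only [map_add, ha, hb]; abel
      | hsmul c a ha => simp [ha, mul_add]
      | he k =>
        simp only [bracketMap_e, map_smul, LinearMap.smul_apply, smul_eq_mul, centralForm_e]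
        by_cases h : n = -(m + k)
        · subst h
          rw [if_pos rfl, if_pos (by ring), if_pos (by ring)]
          push_cast
          ring
        · rw [if_neg h, if_neg (by omega), if_neg (by omega)]
          simp

end WittAlgebra

/-! ### The Virasoro algebra -/

/-- The Virasoro algebra over `K`, as a vector space: the direct sum `K ⊕ WittAlgebra K`. -/
def VirasoroAlgebra (K : Type*) [Field K] : Type _ := K × WittAlgebra K

namespace VirasoroAlgebra

instance {K : Type*} [Field K] : AddCommGroup (VirasoroAlgebra K) :=
  inferInstanceAs (AddCommGroup (K × WittAlgebra K))

instance {K : Type*} [Field K] : Module K (VirasoroAlgebra K) :=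
  inferInstanceAs (Module K (K × WittAlgebra K))

/-- The basis vector `e n`, that is, `(0, e n)`. -/
def e {K : Type*} [Field K] (n : ℤ) : VirasoroAlgebra K := ((0 : K), WittAlgebra.e n)

/-- The central element `t = (1, 0)`. -/
def t {K : Type*} [Field K] : VirasoroAlgebra K := ((1 : K), (0 : WittAlgebra K))

instance {K : Type*} [Field K] [CharZero K] : LieRing (VirasoroAlgebra K) where
  bracket x y := (WittAlgebra.centralForm K x.2 y.2, WittAlgebra.bracketMap K x.2 y.2)
  add_lie x y z := Prod.ext
    (LinearMap.congr_fun ((WittAlgebra.centralForm K).map_add x.2 y.2) z.2)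
    (LinearMap.congr_fun ((WittAlgebra.bracketMap K).map_add x.2 y.2) z.2)
  lie_add x y z := Prod.ext
    ((WittAlgebra.centralForm K x.2).map_add y.2 z.2)
    ((WittAlgebra.bracketMap K x.2).map_add y.2 z.2)
  lie_self x := Prod.ext (WittAlgebra.centralForm_self x.2) (WittAlgebra.bracketMap_self x.2)
  leibniz_lie x y z := Prod.ext
    (WittAlgebra.centralForm_leibniz x.2 y.2 z.2) (WittAlgebra.bracketMap_leibniz x.2 y.2 z.2)

instance {K : Type*} [Field K] [CharZero K] : LieAlgebra K (VirasoroAlgebra K) where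
  lie_smul c x y := Prod.ext
    ((WittAlgebra.centralForm K x.2).map_smul c y.2)
    ((WittAlgebra.bracketMap K x.2).map_smul c y.2)

theorem e_lie_e {K : Type*} [Field K] [CharZero K] (n m : ℤ) :
    ⁅(e n : VirasoroAlgebra K), (e m : VirasoroAlgebra K)⁆ =
      ((m : K) - (n : K)) • e (n + m)
        - (1 / 12 * ((n : K) ^ 3 - (n : K)) * (if n = -m then 1 else 0)) • t := by
  refine Prod.ext ?_ ?_
  · change WittAlgebra.centralForm K (WittAlgebra.e n) (WittAlgebra.e m) =
      ((m : K) - (n : K)) * 0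
        - (1 / 12 * ((n : K) ^ 3 - (n : K)) * (if n = -m then 1 else 0)) * 1
    rw [WittAlgebra.centralForm_e]
    split_ifs <;> ring
  · change WittAlgebra.bracketMap K (WittAlgebra.e n) (WittAlgebra.e m) =
      ((m : K) - (n : K)) • WittAlgebra.e (n + m)
        - (1 / 12 * ((n : K) ^ 3 - (n : K)) * (if n = -m then 1 else 0)) • (0 : WittAlgebra K)
    rw [WittAlgebra.bracketMap_e, smul_zero, sub_zero]

theorem lie_t {K : Type*} [Field K] [CharZero K] (x : VirasoroAlgebra K) :
    ⁅x, (t : VirasoroAlgebra K)⁆ = 0 :=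
  Prod.ext ((WittAlgebra.centralForm K x.2).map_zero) ((WittAlgebra.bracketMap K x.2).map_zero)

end VirasoroAlgebra

/-! ### Deformations over an augmented base, infinitesimal deformations -/

/-- A deformation of the Lie algebra `L` with base the commutative `K`-algebra `A`, augmented by
`π : A → K`: an `A`-Lie algebra structure on `A ⊗ L` such that `π ⊗ id : A ⊗ L → K ⊗ L = L` is
compatible with the brackets. -/
structure LieDeformation (K A L : Type*) [Field K] [CommRing A] [Algebra K A]
    [LieRing L] [LieAlgebra K L] (π : A →ₐ[K] K) where
  /-- the deformed bracket -/
  bracket : A ⊗[K] L →ₗ[A] A ⊗[K] L →ₗ[A] A ⊗[K] L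
  bracket_self : ∀ x, bracket x x = 0
  jacobi : ∀ x y z, bracket (bracket x y) z + bracket (bracket y z) x
    + bracket (bracket z x) y = 0
  reduction : ∀ x y, TensorProduct.lid K L (LinearMap.rTensor L π.toLinearMap (bracket x y)) =
    ⁅TensorProduct.lid K L (LinearMap.rTensor L π.toLinearMap x),
      TensorProduct.lid K L (LinearMap.rTensor L π.toLinearMap y)⁆

theorem lie_lie_cyclic {L : Type*} [LieRing L] (x y z : L) :
    ⁅⁅x, y⁆, z⁆ + ⁅⁅y, z⁆, x⁆ + ⁅⁅z, x⁆, y⁆ = 0 := by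
  have h := lie_jacobi x y z
  rw [← lie_skew x ⁅y, z⁆, ← lie_skew y ⁅z, x⁆, ← lie_skew z ⁅x, y⁆, ← neg_add, ← neg_add,
    neg_eq_zero] at h
  rw [← h]
  abel

namespace LieDeformation

theorem reduction_lie {K A L : Type*} [Field K] [CommRing A] [Algebra K A]
    [LieRing L] [LieAlgebra K L] (π : A →ₐ[K] K) (x y : A ⊗[K] L) :
    TensorProduct.lid K L (LinearMap.rTensor L π.toLinearMap ⁅x, y⁆) =
      ⁅TensorProduct.lid K L (LinearMap.rTensor L π.toLinearMap x),
        TensorProduct.lid K L (LinearMap.rTensor L π.toLinearMap y)⁆ := by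
  induction x using TensorProduct.induction_on with
  | zero => simp
  | add a b ha hb => simp [ha, hb]
  | tmul a u =>
    induction y using TensorProduct.induction_on with
    | zero => simp
    | add a b ha hb => simp [ha, hb]
    | tmul b v => simp [smul_smul, mul_comm]

/-- The trivial deformation: the `A`-bilinear extension of the bracket of `L` to `A ⊗ L`. -/
def trivial (K A L : Type*) [Field K] [CommRing A] [Algebra K A]
    [LieRing L] [LieAlgebra K L] (π : A →ₐ[K] K) : LieDeformation K A L π where
  bracket := LinearMap.mk₂ A (fun x y => ⁅x, y⁆) add_lie smul_lie lie_add (fun c x y => lie_smul c x y)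
  bracket_self x := lie_self x
  jacobi x y z := by
    change ⁅⁅x, y⁆, z⁆ + ⁅⁅y, z⁆, x⁆ + ⁅⁅z, x⁆, y⁆ = 0
    exact lie_lie_cyclic x y z
  reduction x y := reduction_lie π x y

/-- Two deformations with the same base `A` are equivalent if there is an isomorphism of `A`-Lie
algebras between them that is compatible with `π ⊗ id`. -/
def Equivalent {K A L : Type*} [Field K] [CommRing A] [Algebra K A]
    [LieRing L] [LieAlgebra K L] {π : A →ₐ[K] K} (D D' : LieDeformation K A L π) : Prop :=
  ∃ f : (A ⊗[K] L) ≃ₗ[A] (A ⊗[K] L),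
    (∀ x, LinearMap.rTensor L π.toLinearMap (f x) = LinearMap.rTensor L π.toLinearMap x) ∧
    ∀ x y, f (D.bracket x y) = D'.bracket (f x) (f y)

end LieDeformation

/-- `L` is infinitesimally rigid if every infinitesimal deformation of `L`, i.e. every deformation
with base the dual numbers `K[ε]`, `ε ^ 2 = 0`, augmented by `ε ↦ 0`, is equivalent to the
trivial one. -/
def IsInfinitesimallyRigid (K L : Type*) [Field K] [LieRing L] [LieAlgebra K L] : Prop :=
  ∀ D : LieDeformation K K[ε] L (TrivSqZeroExt.fstHom K K K),
    D.Equivalent (LieDeformation.trivial K K[ε] L (TrivSqZeroExt.fstHom K K K))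

/-! ### Formal one-parameter deformations -/

/-- A formal one-parameter deformation of the Lie algebra `L`: a family of bilinear maps
`coeff n`, `n ∈ ℕ`, where `coeff 0` is the bracket of `L`, such that the `K⟦t⟧`-bilinear
extension of `[x, y]_t = ∑ n, coeff n x y * t ^ n` is a Lie bracket on `L⟦t⟧`. The Jacobi identity
is the vanishing of each coefficient of `[[x, y]_t, z]_t + cyclic permutations`. -/
structure FormalDeformation (K L : Type*) [Field K] [LieRing L] [LieAlgebra K L] where
  /-- the coefficient of `t ^ n` in the deformed bracket -/
  coeff : ℕ → L →ₗ[K] L →ₗ[K] L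
  coeff_zero : ∀ x y, coeff 0 x y = ⁅x, y⁆
  coeff_self : ∀ n x, coeff n x x = 0
  jacobi : ∀ n x y z, ∑ p ∈ Finset.HasAntidiagonal.antidiagonal n,
    (coeff p.1 (coeff p.2 x y) z + coeff p.1 (coeff p.2 y z) x
      + coeff p.1 (coeff p.2 z x) y) = 0

namespace FormalDeformation

/-- The trivial formal deformation: `[x, y]_t = [x, y]`. -/
def trivial (K L : Type*) [Field K] [LieRing L] [LieAlgebra K L] :
    FormalDeformation K L where
  coeff n := if n = 0 then LinearMap.mk₂ K (fun x y => ⁅x, y⁆) add_lie smul_lie lie_add (fun c x y => lie_smul c x y) else 0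
  coeff_zero x y := rfl
  coeff_self n x := by
    split_ifs
    · exact lie_self x
    · rfl
  jacobi n x y z := by
    refine Finset.sum_eq_zero fun p _ => ?_
    by_cases h1 : p.1 = 0
    · by_cases h2 : p.2 = 0
      · rw [if_pos h1, if_pos h2]
        change ⁅⁅x, y⁆, z⁆ + ⁅⁅y, z⁆, x⁆ + ⁅⁅z, x⁆, y⁆ = 0
        exact lie_lie_cyclic x y z
      · simp [h2]
    · simp [h1]

/-- Two formal deformations are equivalent if there is a formal automorphism
`Φ = id + ∑ n ≥ 1, Φ n * t ^ n` with `Φ n : L → L` linear, such that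
`Φ [x, y]_t = [Φ x, Φ y]'_t`; the identity is written coefficient by coefficient. -/
def Equivalent {K L : Type*} [Field K] [LieRing L] [LieAlgebra K L]
    (D D' : FormalDeformation K L) : Prop :=
  ∃ Φ : ℕ → L →ₗ[K] L, Φ 0 = LinearMap.id ∧
    ∀ n x y, ∑ p ∈ Finset.HasAntidiagonal.antidiagonal n, Φ p.1 (D.coeff p.2 x y) =
      ∑ p ∈ Finset.HasAntidiagonal.antidiagonal n, ∑ q ∈ Finset.HasAntidiagonal.antidiagonal p.2,
        D'.coeff p.1 (Φ q.1 x) (Φ q.2 y)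

end FormalDeformation

/-- `L` is formally rigid if every formal one-parameter deformation of `L` is equivalent to the
trivial one. -/
def IsFormallyRigid (K L : Type*) [Field K] [LieRing L] [LieAlgebra K L] : Prop :=
  ∀ D : FormalDeformation K L, D.Equivalent (FormalDeformation.trivial K L)

end

/-! Both kinds of rigidity follow from the vanishing of the second cohomology of `L` with adjoint
coefficients (`HasTrivialH2`). The `ε`-term of an infinitesimal deformation is a cocycle; if it is
the coboundary of `φ`, then `id - εφ` trivializes the deformation. In the formal case `Φ` is built
term by term: once the lower orders agree, the order-`n` failure of `Φ` to be a homomorphism is a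
cocycle (`isAdjointCocycle_defect`), and changing `Φ n` by `φ` changes it by the coboundary of `φ`
(`defect_update`).

For the cohomology, `e 0` acts diagonally with integral eigenvalues. In characteristic `0` the
nonzero differences of eigenvalues are invertible, so every cocycle is cohomologous to one of degree
zero (`exists_homogeneous`). For the Witt algebra such a cocycle is a scalar function `ψ n m`. A
cochain `e n ↦ φ n • e n` normalizes `ψ n 1 = 0` and `ψ (-1) 2 = 0`, after which the cocycle
identities with `e 1` and `e (-1)` are recurrences that force `ψ = 0`.

For the Virasoro algebra, three corrections suffice: one makes the cocycle vanish on `t`, one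
removes the `e`-components by the Witt result, and the remaining central values are `a n + c (n ^ 3
- n)` on `(e n, e (-n))`, which is a coboundary because `t` itself can be rescaled. -/

section Cohomology

variable {K L : Type*} [Field K] [LieRing L] [LieAlgebra K L]

/-- Alternating `2`-cocycles of a Lie algebra with values in the adjoint module. -/
structure IsAdjointCocycle (ψ : L →ₗ[K] L →ₗ[K] L) : Prop where
  self : ∀ x, ψ x x = 0
  cyclic : ∀ x y z, (ψ ⁅x, y⁆ z + ⁅ψ x y, z⁆) + (ψ ⁅y, z⁆ x + ⁅ψ y z, x⁆)
    + (ψ ⁅z, x⁆ y + ⁅ψ z x, y⁆) = 0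

/-- The coboundary of a `1`-cochain with values in the adjoint module. -/
def adjointCoboundary (φ : L →ₗ[K] L) : L →ₗ[K] L →ₗ[K] L :=
  LinearMap.mk₂ K (fun x y => φ ⁅x, y⁆ - ⁅φ x, y⁆ - ⁅x, φ y⁆)
    (fun x x' y => by simp only [add_lie, map_add]; abel)
    (fun c x y => by simp only [smul_lie, map_smul, smul_sub])
    (fun x y y' => by simp only [lie_add, map_add]; abel)
    (fun c x y => by simp only [lie_smul, map_smul, smul_sub])

theorem adjointCoboundary_apply (φ : L →ₗ[K] L) (x y : L) :
    adjointCoboundary φ x y = φ ⁅x, y⁆ - ⁅φ x, y⁆ - ⁅x, φ y⁆ := rfl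

theorem adjointCoboundary_add (φ φ' : L →ₗ[K] L) :
    adjointCoboundary (φ + φ') = adjointCoboundary φ + adjointCoboundary φ' := by
  ext x y
  simp only [adjointCoboundary_apply, LinearMap.add_apply, add_lie, lie_add]
  abel

variable (K L) in
/-- The second cohomology of `L` with values in the adjoint module vanishes. -/
def HasTrivialH2 : Prop :=
  ∀ ψ : L →ₗ[K] L →ₗ[K] L, IsAdjointCocycle ψ → ∃ φ, ψ = adjointCoboundary φ

namespace IsAdjointCocycle

variable {ψ : L →ₗ[K] L →ₗ[K] L}

theorem skew (h : IsAdjointCocycle ψ) (x y : L) : ψ x y = -ψ y x := by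
  have := h.self (x + y)
  simp only [map_add, LinearMap.add_apply, h.self, zero_add, add_zero] at this
  exact eq_neg_of_add_eq_zero_right this

/-- Coboundaries satisfy the cyclic identity: combine `φ` of the Jacobi identity with the three
Jacobi identities in which one entry is replaced by its image under `φ`. -/
theorem sub_coboundary (h : IsAdjointCocycle ψ) (φ : L →ₗ[K] L) :
    IsAdjointCocycle (ψ - adjointCoboundary φ) where
  self x := by
    simp only [LinearMap.sub_apply, h.self, adjointCoboundary_apply, lie_self, map_zero]
    rw [← lie_skew x (φ x)]
    abel
  cyclic x y z := by
    have h1 := h.cyclic x y z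
    have h2 := congrArg φ (lie_lie_cyclic x y z)
    have h3 := lie_lie_cyclic (φ x) y z
    have h4 := lie_lie_cyclic x (φ y) z
    have h5 := lie_lie_cyclic x y (φ z)
    simp only [map_add, map_zero] at h2
    simp only [LinearMap.sub_apply, adjointCoboundary_apply, sub_lie]
    have e : ∀ a b : L, ⁅a, b⁆ = -⁅b, a⁆ := fun a b => (lie_skew a b).symm
    rw [e ⁅x, y⁆ (φ z), e ⁅y, z⁆ (φ x), e ⁅z, x⁆ (φ y)]
    rw [e ⁅y, z⁆ (φ x)] at h3
    rw [e ⁅z, x⁆ (φ y)] at h4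
    rw [e ⁅x, y⁆ (φ z)] at h5
    linear_combination (norm := module) h1 - h2 + h3 + h4 + h5

theorem exists_of_sub (φ : L →ₗ[K] L)
    (hφ : ∃ φ', ψ - adjointCoboundary φ = adjointCoboundary φ') :
    ∃ φ', ψ = adjointCoboundary φ' := by
  obtain ⟨φ', h⟩ := hφ
  exact ⟨φ' + φ, by rw [adjointCoboundary_add, ← h, sub_add_cancel]⟩

end IsAdjointCocycle

end Cohomology

/-! ### Infinitesimal rigidity -/

section AddNilpotent

variable {K A L : Type*} [Field K] [CommRing A] [Algebra K A] [LieRing L] [LieAlgebra K L]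

/-- The map `id + a φ` of `A ⊗ L`. -/
def addSMul (a : A) (φ : L →ₗ[K] L) : A ⊗[K] L →ₗ[A] A ⊗[K] L :=
  LinearMap.id + a • φ.baseChange A

theorem addSMul_tmul (a b : A) (φ : L →ₗ[K] L) (x : L) :
    addSMul a φ (b ⊗ₜ x) = b ⊗ₜ x + a • (b ⊗ₜ φ x) := rfl

theorem addSMul_comp_neg {a : A} (ha : a * a = 0) (φ : L →ₗ[K] L) :
    addSMul a φ ∘ₗ addSMul a (-φ) = LinearMap.id := by
  ext x
  simp [addSMul_tmul, smul_smul, TensorProduct.tmul_neg, ha]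

/-- The automorphism `id + a φ` of `A ⊗ L`, where `a ^ 2 = 0`. -/
def addSMulEquiv {a : A} (ha : a * a = 0) (φ : L →ₗ[K] L) : (A ⊗[K] L) ≃ₗ[A] (A ⊗[K] L) :=
  LinearEquiv.ofLinearMap (addSMul a φ) (addSMul a (-φ)) (addSMul_comp_neg ha φ)
    (by simpa using addSMul_comp_neg ha (-φ))

theorem addSMul_lie {a : A} (ha : a * a = 0) (φ : L →ₗ[K] L) (x y : L) :
    ⁅addSMul a φ (1 ⊗ₜ x), addSMul a φ (1 ⊗ₜ y)⁆ =
      addSMul a φ (1 ⊗ₜ ⁅x, y⁆ - a • (1 ⊗ₜ adjointCoboundary φ x y)) := by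
  rw [map_sub, map_smul]
  simp only [addSMul_tmul, smul_add, smul_smul, ha, zero_smul, add_zero, lie_add, add_lie,
    lie_smul, smul_lie, LieAlgebra.ExtendScalars.bracket_tmul, mul_one]
  simp only [adjointCoboundary_apply, TensorProduct.tmul_sub, smul_sub]
  abel

end AddNilpotent

section Infinitesimal

variable {K L : Type*} [Field K] [LieRing L] [LieAlgebra K L]

/-- The coefficient of `ε` of an element of `K[ε] ⊗ L`. -/
def epsCoeff (K L : Type*) [Field K] [LieRing L] [LieAlgebra K L] : K[ε] ⊗[K] L →ₗ[K] L :=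
  (TensorProduct.lid K L).toLinearMap ∘ₗ LinearMap.rTensor L (TrivSqZeroExt.sndHom K K)

/-- The constant coefficient of an element of `K[ε] ⊗ L`. -/
def constCoeff (K L : Type*) [Field K] [LieRing L] [LieAlgebra K L] : K[ε] ⊗[K] L →ₗ[K] L :=
  (TensorProduct.lid K L).toLinearMap ∘ₗ
    LinearMap.rTensor L (TrivSqZeroExt.fstHom K K K).toLinearMap

@[simp] theorem epsCoeff_tmul (a : K[ε]) (x : L) : epsCoeff K L (a ⊗ₜ x) = a.snd • x := rfl

@[simp] theorem constCoeff_tmul (a : K[ε]) (x : L) : constCoeff K L (a ⊗ₜ x) = a.fst • x := rfl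

theorem constCoeff_smul (a : K[ε]) (u : K[ε] ⊗[K] L) :
    constCoeff K L (a • u) = a.fst • constCoeff K L u := by
  induction u using TensorProduct.induction_on with
  | zero => simp
  | add u v hu hv => simp only [smul_add, map_add, hu, hv]
  | tmul b x => simp [TensorProduct.smul_tmul', smul_smul]

theorem epsCoeff_smul (a : K[ε]) (u : K[ε] ⊗[K] L) :
    epsCoeff K L (a • u) = a.fst • epsCoeff K L u + a.snd • constCoeff K L u := by
  induction u using TensorProduct.induction_on with
  | zero => simp
  | add u v hu hv => simp only [smul_add, map_add, hu, hv]; abel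
  | tmul b x => simp [TensorProduct.smul_tmul', smul_smul, add_smul, mul_comm]

theorem eq_constCoeff_add_epsCoeff (u : K[ε] ⊗[K] L) :
    u = 1 ⊗ₜ constCoeff K L u + (ε : K[ε]) • (1 ⊗ₜ epsCoeff K L u) := by
  induction u using TensorProduct.induction_on with
  | zero => simp
  | add u v hu hv =>
    nth_rewrite 1 [hu, hv]
    simp only [map_add, TensorProduct.tmul_add, smul_add]
    abel
  | tmul b x =>
    simp only [constCoeff_tmul, epsCoeff_tmul, TensorProduct.smul_tmul', ← TensorProduct.smul_tmul,
      ← TensorProduct.add_tmul]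
    congr 1
    ext <;> simp

namespace LieDeformation

variable (D : LieDeformation K K[ε] L (TrivSqZeroExt.fstHom K K K))

/-- The first order term of an infinitesimal deformation. -/
def firstOrder : L →ₗ[K] L →ₗ[K] L :=
  LinearMap.mk₂ K (fun x y => epsCoeff K L (D.bracket (1 ⊗ₜ x) (1 ⊗ₜ y)))
    (fun x x' y => by simp only [TensorProduct.tmul_add, map_add, LinearMap.add_apply])
    (fun c x y => by
      simp only [TensorProduct.tmul_smul, LinearMap.map_smul_of_tower, LinearMap.smul_apply])
    (fun x y y' => by simp only [TensorProduct.tmul_add, map_add])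
    (fun c x y => by simp only [TensorProduct.tmul_smul, LinearMap.map_smul_of_tower])

theorem firstOrder_apply (x y : L) :
    D.firstOrder x y = epsCoeff K L (D.bracket (1 ⊗ₜ x) (1 ⊗ₜ y)) := rfl

theorem constCoeff_bracket (u v : K[ε] ⊗[K] L) :
    constCoeff K L (D.bracket u v) = ⁅constCoeff K L u, constCoeff K L v⁆ := D.reduction u v

theorem bracket_one_tmul (x y : L) : D.bracket (1 ⊗ₜ x) (1 ⊗ₜ y) =
    1 ⊗ₜ ⁅x, y⁆ + (ε : K[ε]) • (1 ⊗ₜ D.firstOrder x y) := by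
  rw [eq_constCoeff_add_epsCoeff (D.bracket _ _), constCoeff_bracket, firstOrder_apply]
  simp

/-- Each of the two nested brackets contributes its first-order term once. The cyclic sum turns the
deformed Jacobi identity into the cocycle identity. -/
theorem epsCoeff_bracket_bracket (x y z : L) :
    epsCoeff K L (D.bracket (D.bracket (1 ⊗ₜ x) (1 ⊗ₜ y)) (1 ⊗ₜ z)) =
      D.firstOrder ⁅x, y⁆ z + ⁅D.firstOrder x y, z⁆ := by
  rw [bracket_one_tmul, map_add, LinearMap.add_apply, map_add, firstOrder_apply D ⁅x, y⁆, map_smul,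
    LinearMap.smul_apply, epsCoeff_smul, constCoeff_bracket]
  simp

theorem isAdjointCocycle_firstOrder : IsAdjointCocycle D.firstOrder where
  self x := by rw [firstOrder_apply, D.bracket_self, map_zero]
  cyclic x y z := by
    simp only [← epsCoeff_bracket_bracket, ← map_add, D.jacobi, map_zero]

end LieDeformation

theorem HasTrivialH2.isInfinitesimallyRigid (h : HasTrivialH2 K L) :
    IsInfinitesimallyRigid K L := by
  intro D
  obtain ⟨φ, hφ⟩ := h _ D.isAdjointCocycle_firstOrder
  have hε : (ε : K[ε]) * ε = 0 := DualNumber.eps_mul_eps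
  -- The sign is forced by `addSMul_lie`: conjugation by `id + εφ` subtracts the coboundary of `φ`
  -- from the first-order term.
  refine ⟨addSMulEquiv hε (-φ), fun u => ?_, fun u v => ?_⟩
  · refine (TensorProduct.lid K L).injective ?_
    change constCoeff K L (u + (ε : K[ε]) • (-φ).baseChange K[ε] u) = constCoeff K L u
    rw [map_add, constCoeff_smul]
    simp
  -- Both sides are `K[ε]`-bilinear, so they need only be compared on elements `1 ⊗ₜ x`.
  · have key : D.bracket.compr₂ (addSMul ε (-φ)) =
        (LieDeformation.trivial K K[ε] L (TrivSqZeroExt.fstHom K K K)).bracket.compl₁₂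
          (addSMul ε (-φ)) (addSMul ε (-φ)) := by
      ext x y
      refine (congrArg (addSMul (ε : K[ε]) (-φ)) ?_).trans (addSMul_lie hε (-φ) x y).symm
      refine (D.bracket_one_tmul x y).trans ?_
      have e : adjointCoboundary (-φ) x y = -D.firstOrder x y := by
        rw [hφ]
        simp only [adjointCoboundary_apply, LinearMap.neg_apply, neg_lie, lie_neg]
        abel
      rw [e, TensorProduct.tmul_neg, smul_neg, sub_neg_eq_add]
    exact LinearMap.congr_fun₂ key u v

end Infinitesimal

/-! ### Formal rigidity -/

open Finset.HasAntidiagonal (antidiagonal)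

section Formal

/-- Dependent choice: a sequence can be constructed by successive modification of its `n`-th
term. -/
theorem exists_seq_of_update {A : Type*} [Inhabited A] (P : ℕ → (ℕ → A) → Prop)
    (hloc : ∀ n f g, (∀ i ≤ n, f i = g i) → P n f → P n g)
    (hstep : ∀ n f, (∀ i < n, P i f) → ∃ a, P n (Function.update f n a)) :
    ∃ f, ∀ n, P n f := by
  choose! a ha using hstep
  -- `F n` is the sequence once its terms below `n` are fixed. Term `i` is set in `F (i + 1)` and
  -- never changes again, so the diagonal is the required sequence.
  let F : ℕ → ℕ → A := fun n => Nat.rec (fun _ => default) (fun n f => Function.update f n (a n f)) n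
  have hF : ∀ n, F (n + 1) = Function.update (F n) n (a n (F n)) := fun _ => rfl
  have hag : ∀ m i, i < m → F m i = F (i + 1) i := fun m => by
    induction m with
    | zero => intro i hi; omega
    | succ m ih =>
      intro i hi
      rcases eq_or_ne i m with rfl | hne
      · rfl
      · rw [hF, Function.update_of_ne hne, ih i (by omega)]
  refine ⟨fun i => F (i + 1) i, fun n => ?_⟩
  induction n using Nat.strong_induction_on with
  | _ n ih =>
    refine hloc n (F (n + 1)) _ (fun i hi => hag (n + 1) i (by omega)) ?_
    rw [hF]
    refine ha n _ fun i hi => hloc i _ _ (fun j hj => ?_) (ih i hi)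
    exact (hag n j (by omega)).symm

variable {M : Type*} [AddCommMonoid M]

theorem sum_antidiagonal_assoc (n : ℕ) (F : ℕ → ℕ → ℕ → M) :
    ∑ p ∈ antidiagonal n, ∑ q ∈ antidiagonal p.1, F q.1 q.2 p.2 =
      ∑ p ∈ antidiagonal n, ∑ q ∈ antidiagonal p.2, F p.1 q.1 q.2 := by
  rw [Finset.sum_sigma', Finset.sum_sigma']
  refine Finset.sum_nbij' (fun x => ⟨(x.2.1, x.2.2 + x.1.2), (x.2.2, x.1.2)⟩)
    (fun x => ⟨(x.1.1 + x.2.1, x.2.2), (x.1.1, x.2.1)⟩) ?_ ?_ ?_ ?_ ?_ <;>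
  · rintro ⟨⟨a, b⟩, ⟨c, d⟩⟩ h
    simp only [Finset.mem_sigma, Finset.HasAntidiagonal.mem_antidiagonal] at h
    obtain ⟨rfl, rfl⟩ := h
    simp [add_assoc]

/-- Used to match the three cyclic terms of the Jacobi identity on the same triple of indices. -/
theorem sum_antidiagonal_rotate (n : ℕ) (F : ℕ → ℕ → ℕ → M) :
    ∑ p ∈ antidiagonal n, ∑ q ∈ antidiagonal p.1, F q.1 q.2 p.2 =
      ∑ p ∈ antidiagonal n, ∑ q ∈ antidiagonal p.1, F q.2 p.2 q.1 := by
  rw [sum_antidiagonal_assoc n fun i j k => F j k i, ← Finset.Nat.sum_antidiagonal_swap]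
  rfl

variable {K L : Type*} [Field K] [LieRing L] [LieAlgebra K L]

namespace FormalDeformation

variable (D : FormalDeformation K L)

/-- The coefficient of `t ^ n` in `Φ [x, y]_t - [Φ x, Φ y]`. -/
def defect (Φ : ℕ → L →ₗ[K] L) (n : ℕ) : L →ₗ[K] L →ₗ[K] L :=
  LinearMap.mk₂ K (fun x y => ∑ p ∈ antidiagonal n, Φ p.1 (D.coeff p.2 x y) -
      ∑ p ∈ antidiagonal n, ⁅Φ p.1 x, Φ p.2 y⁆)
    (fun x x' y => by
      simp only [map_add, LinearMap.add_apply, add_lie, Finset.sum_add_distrib]; abel)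
    (fun c x y => by
      simp only [map_smul, LinearMap.smul_apply, smul_lie, smul_sub, Finset.smul_sum])
    (fun x y y' => by simp only [map_add, lie_add, Finset.sum_add_distrib]; abel)
    (fun c x y => by simp only [map_smul, lie_smul, smul_sub, Finset.smul_sum])

theorem defect_apply (Φ : ℕ → L →ₗ[K] L) (n : ℕ) (x y : L) :
    D.defect Φ n x y = ∑ p ∈ antidiagonal n, Φ p.1 (D.coeff p.2 x y) -
      ∑ p ∈ antidiagonal n, ⁅Φ p.1 x, Φ p.2 y⁆ := rfl

theorem defect_congr {Φ Φ' : ℕ → L →ₗ[K] L} {n : ℕ} (h : ∀ i ≤ n, Φ i = Φ' i) :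
    D.defect Φ n = D.defect Φ' n := by
  ext x y
  rw [defect_apply, defect_apply]
  congr 1 <;> refine Finset.sum_congr rfl fun p hp => ?_ <;>
    rw [Finset.HasAntidiagonal.mem_antidiagonal] at hp
  · rw [h _ (by omega)]
  · rw [h _ (by omega), h _ (by omega)]

/-- In the sum of brackets, the terms for `(i, j)` and `(j, i)` cancel by skew-symmetry, and a term
with `i = j` is zero. -/
theorem defect_self (Φ : ℕ → L →ₗ[K] L) (n : ℕ) (x : L) : D.defect Φ n x x = 0 := by
  have hs : ∑ p ∈ antidiagonal n, ⁅Φ p.1 x, Φ p.2 x⁆ = 0 :=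
    Finset.sum_involution (fun p _ => p.swap)
      (fun p _ => by
        rw [← lie_skew (Φ p.1 x) (Φ p.2 x)]
        exact neg_add_cancel _)
      (fun p _ hp he => hp <| by
        rw [show p.2 = p.1 from congrArg Prod.fst he, lie_self])
      (fun p hp => Finset.HasAntidiagonal.swap_mem_antidiagonal.mpr hp) (fun p _ => p.swap_swap)
  simp [defect_apply, D.coeff_self, hs]

/-- This is the coefficient of `t ^ n` in a telescoping sum: `Φ[[x,y],z] - [Φ[x,y],Φz]` plus
`[Φ[x,y],Φz] - [[Φx,Φy],Φz]`. -/
theorem sum_defect_add (Φ : ℕ → L →ₗ[K] L) (n : ℕ) (x y z : L) :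
    ∑ p ∈ antidiagonal n, (D.defect Φ p.1 (D.coeff p.2 x y) z + ⁅D.defect Φ p.1 x y, Φ p.2 z⁆) =
      ∑ p ∈ antidiagonal n, Φ p.1 (∑ q ∈ antidiagonal p.2, D.coeff q.1 (D.coeff q.2 x y) z) -
      ∑ p ∈ antidiagonal n, ∑ q ∈ antidiagonal p.1, ⁅⁅Φ q.1 x, Φ q.2 y⁆, Φ p.2 z⁆ := by
  simp only [defect_apply, sub_lie, Finset.sum_add_distrib, Finset.sum_sub_distrib,
    sum_lie, map_sum]
  rw [sum_antidiagonal_assoc n fun i j k => Φ i (D.coeff j (D.coeff k x y) z)]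
  have e : ∑ p ∈ antidiagonal n, ∑ q ∈ antidiagonal p.1, ⁅Φ q.1 (D.coeff p.2 x y), Φ q.2 z⁆ =
      ∑ p ∈ antidiagonal n, ∑ q ∈ antidiagonal p.1, ⁅Φ q.1 (D.coeff q.2 x y), Φ p.2 z⁆ := by
    rw [sum_antidiagonal_assoc n fun i j k => ⁅Φ i (D.coeff k x y), Φ j z⁆,
      sum_antidiagonal_assoc n fun i j k => ⁅Φ i (D.coeff j x y), Φ k z⁆]
    exact Finset.sum_congr rfl fun p _ => (Finset.Nat.sum_antidiagonal_swap).symm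
  rw [e]
  abel

/-- As lower defects vanish, only the index `(n, 0)` survives on the left of `sum_defect_add`, which
leaves a cocycle expression. The cyclic sum of the right side vanishes by the Jacobi identities of
the deformed bracket and of `L`. -/
theorem isAdjointCocycle_defect {Φ : ℕ → L →ₗ[K] L} {n : ℕ} (h0 : Φ 0 = LinearMap.id)
    (h : ∀ i < n, D.defect Φ i = 0) : IsAdjointCocycle (D.defect Φ n) where
  self := D.defect_self Φ n
  cyclic x y z := by
    have key : ∀ x y z, D.defect Φ n ⁅x, y⁆ z + ⁅D.defect Φ n x y, z⁆ =
        ∑ p ∈ antidiagonal n,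
          (D.defect Φ p.1 (D.coeff p.2 x y) z + ⁅D.defect Φ p.1 x y, Φ p.2 z⁆) := fun x y z => by
      rw [Finset.sum_eq_single_of_mem (n, 0) (by simp), D.coeff_zero, h0, LinearMap.id_apply]
      rintro ⟨i, j⟩ hp hne
      rw [Finset.HasAntidiagonal.mem_antidiagonal] at hp
      have : i < n := by
        rcases Nat.eq_zero_or_pos j with rfl | hj
        · exact absurd (by simpa using hp) hne
        · simp only at hp; omega
      simp [h i this]
    rw [key, key, key]
    simp only [sum_defect_add]
    rw [sum_antidiagonal_rotate n fun i j k => ⁅⁅Φ i y, Φ j z⁆, Φ k x⁆,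
      ← sum_antidiagonal_rotate n fun i j k => ⁅⁅Φ k z, Φ i x⁆, Φ j y⁆]
    have h1 : ∑ p ∈ antidiagonal n, Φ p.1 (∑ q ∈ antidiagonal p.2,
        (D.coeff q.1 (D.coeff q.2 x y) z + D.coeff q.1 (D.coeff q.2 y z) x
          + D.coeff q.1 (D.coeff q.2 z x) y)) = 0 :=
      Finset.sum_eq_zero fun p _ => by rw [D.jacobi, map_zero]
    have h2 : ∑ p ∈ antidiagonal n, ∑ q ∈ antidiagonal p.1,
        (⁅⁅Φ q.1 x, Φ q.2 y⁆, Φ p.2 z⁆ + ⁅⁅Φ q.2 y, Φ p.2 z⁆, Φ q.1 x⁆ +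
          ⁅⁅Φ p.2 z, Φ q.1 x⁆, Φ q.2 y⁆) = 0 :=
      Finset.sum_eq_zero fun p _ => Finset.sum_eq_zero fun q _ => lie_lie_cyclic _ _ _
    simp only [Finset.sum_add_distrib, map_add] at h1 h2
    linear_combination (norm := module) h1 - h2

/-- In order `n` the term `Φ n` meets only zeroth-order terms, namely the bracket of `L` and `Φ 0 =
id`. -/
theorem defect_update {Φ : ℕ → L →ₗ[K] L} {n : ℕ} (hn : n ≠ 0) (h0 : Φ 0 = LinearMap.id)
    (φ : L →ₗ[K] L) :
    D.defect (Function.update Φ n (Φ n + φ)) n = D.defect Φ n + adjointCoboundary φ := by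
  have hu : Function.update Φ n (Φ n + φ) = fun i => Φ i + if i = n then φ else 0 := by
    funext i
    rcases eq_or_ne i n with rfl | hi
    · simp
    · simp [hi]
  have h3 : ∀ f : ℕ → ℕ → L, (∑ p ∈ antidiagonal n, if p.1 = n then f p.1 p.2 else 0) = f n 0 :=
    fun f => by
      rw [Finset.sum_eq_single_of_mem (n, 0) (by simp), if_pos rfl]
      rintro ⟨i, j⟩ hp hne
      rw [Finset.HasAntidiagonal.mem_antidiagonal] at hp
      refine if_neg fun hi => hne ?_
      simp only at hp hi
      ext <;> simp only <;> omega
  have h4 : ∀ f : ℕ → ℕ → L, (∑ p ∈ antidiagonal n, if p.2 = n then f p.1 p.2 else 0) = f 0 n :=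
    fun f => by
      rw [← Finset.Nat.sum_antidiagonal_swap]
      exact h3 fun i j => f j i
  have ite_app : ∀ (i : ℕ) (x : L), (if i = n then φ else 0) x = if i = n then φ x else 0 :=
    fun i x => by split_ifs <;> rfl
  ext x y
  rw [hu]
  -- The part quadratic in `φ` would need both indices equal to `n`, impossible since they sum to `n
  -- ≠ 0`.
  have h5 : ∑ p ∈ antidiagonal n, ⁅(if p.1 = n then φ else 0) x, (if p.2 = n then φ else 0) y⁆ = 0 :=
    Finset.sum_eq_zero fun p hp => by
      rw [Finset.HasAntidiagonal.mem_antidiagonal] at hp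
      by_cases h1 : p.1 = n
      · rw [if_neg (show p.2 ≠ n by omega), LinearMap.zero_apply, lie_zero]
      · rw [if_neg h1, LinearMap.zero_apply, zero_lie]
  simp only [defect_apply, LinearMap.add_apply, lie_add, add_lie, Finset.sum_add_distrib, h5]
  have h6 : ∑ p ∈ antidiagonal n, (if p.1 = n then φ else 0) (D.coeff p.2 x y) = φ ⁅x, y⁆ := by
    simp only [ite_app]
    rw [h3 fun i j => φ (D.coeff j x y), D.coeff_zero]
  have h7 : ∑ p ∈ antidiagonal n, ⁅(if p.1 = n then φ else 0) x, Φ p.2 y⁆ = ⁅φ x, y⁆ := by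
    refine Eq.trans (Finset.sum_congr rfl fun p _ => ?_)
      ((h3 fun i j => ⁅φ x, Φ j y⁆).trans (by rw [h0]; rfl))
    split_ifs <;> simp
  have h8 : ∑ p ∈ antidiagonal n, ⁅Φ p.1 x, (if p.2 = n then φ else 0) y⁆ = ⁅x, φ y⁆ := by
    refine Eq.trans (Finset.sum_congr rfl fun p _ => ?_)
      ((h4 fun i j => ⁅Φ i x, φ y⁆).trans (by rw [h0]; rfl))
    split_ifs <;> simp
  rw [h6, h7, h8, adjointCoboundary_apply]
  abel

end FormalDeformation

theorem HasTrivialH2.isFormallyRigid (h : HasTrivialH2 K L) : IsFormallyRigid K L := by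
  intro D
  obtain ⟨Φ, hΦ⟩ := exists_seq_of_update
    -- The condition `Φ 0 = id` is carried along at every order, because the cocycle property of the
    -- next defect depends on it.
    (fun n (Φ : ℕ → L →ₗ[K] L) => Φ 0 = LinearMap.id ∧ D.defect Φ n = 0)
    (fun n f g hfg hf => ⟨hfg 0 n.zero_le ▸ hf.1, D.defect_congr hfg ▸ hf.2⟩)
    (fun n f hf => by
      rcases Nat.eq_zero_or_pos n with rfl | hn
      · refine ⟨LinearMap.id, by simp, ?_⟩
        ext x y
        simp [FormalDeformation.defect_apply, D.coeff_zero]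
      · obtain ⟨φ, hφ⟩ := h _ (D.isAdjointCocycle_defect (hf 0 hn).1 fun i hi => (hf i hi).2)
        refine ⟨f n + -φ, by rw [Function.update_of_ne hn.ne, (hf 0 hn).1], ?_⟩
        rw [D.defect_update hn.ne' (hf 0 hn).1, hφ, ← adjointCoboundary_add, add_neg_cancel]
        ext x y
        simp [adjointCoboundary_apply])
  refine ⟨Φ, (hΦ 0).1, fun n x y => ?_⟩
  have h1 := LinearMap.congr_fun₂ (hΦ n).2 x y
  rw [FormalDeformation.defect_apply, LinearMap.zero_apply, LinearMap.zero_apply, sub_eq_zero] at h1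
  rw [h1]
  symm
  rw [Finset.sum_eq_single_of_mem (0, n) (by simp)]
  · rfl
  · rintro ⟨i, j⟩ hp hne
    refine Finset.sum_eq_zero fun q _ => ?_
    rw [Finset.HasAntidiagonal.mem_antidiagonal] at hp
    have : i ≠ 0 := fun hi => hne (by simp only at hp; ext <;> simp only <;> omega)
    simp [FormalDeformation.trivial, this]

end Formal

/-! ### Degree-zero cocycles of the Witt algebra -/

/-- Any function on `ℤ` has a discrete antiderivative vanishing at `1`. -/
theorem exists_discrete_primitive {A : Type*} [AddCommGroup A] (g : ℤ → A) :
    ∃ F : ℤ → A, F 1 = 0 ∧ ∀ n, F (n + 1) = F n + g n := by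
  let G : ℤ → A
    | Int.ofNat m => ∑ i ∈ Finset.range m, g i
    | Int.negSucc m => -∑ i ∈ Finset.range (m + 1), g (Int.negSucc i)
  have hG : ∀ n, G (n + 1) = G n + g n := by
    rintro (m | m)
    · exact Finset.sum_range_succ (fun i : ℕ => g i) m
    · rcases m with _ | m
      · change (∑ i ∈ Finset.range 0, g i) =
          -(∑ i ∈ Finset.range 1, g (Int.negSucc i)) + g (Int.negSucc 0)
        simp
      · change -(∑ i ∈ Finset.range (m + 1), g (Int.negSucc i)) =
          -(∑ i ∈ Finset.range (m + 2), g (Int.negSucc i)) + g (Int.negSucc (m + 1))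
        rw [Finset.sum_range_succ _ (m + 1)]
        abel
  exact ⟨fun n => G n - G 1, sub_self _, fun n => by simp only [hG]; abel⟩

/-- The structure constants `[e n, e m] ↦ ψ n m` of a `2`-cochain of degree zero of the Witt
algebra form a cocycle. -/
structure IsWittCocycle {K : Type*} [Field K] (ψ : ℤ → ℤ → K) : Prop where
  skew : ∀ n m, ψ n m = -ψ m n
  cyclic : ∀ n m k : ℤ,
    ((m : K) - n) * ψ (n + m) k + ((k : K) - (n + m)) * ψ n m +
    (((k : K) - m) * ψ (m + k) n + ((n : K) - (m + k)) * ψ m k) +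
    (((n : K) - k) * ψ (k + n) m + ((m : K) - (k + n)) * ψ k n) = 0

namespace IsWittCocycle

variable {K : Type*} [Field K] {ψ : ℤ → ℤ → K}

/-- A function on `ℤ` with `F (n + 1) = 0` whenever `F n = 0` vanishes from any zero on. -/
theorem eq_zero_of_le {F : ℤ → K} {a : ℤ} (h : F a = 0)
    (hs : ∀ n, a ≤ n → F n = 0 → F (n + 1) = 0) : ∀ n, a ≤ n → F n = 0 := fun n hn =>
  Int.leInduction (motive := fun n _ => F n = 0) h (fun n hn ih => hs n hn ih) n hn

theorem eq_zero_of_ge {F : ℤ → K} {a : ℤ} (h : F a = 0)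
    (hs : ∀ n, n < a → F (n + 1) = 0 → F n = 0) : ∀ n, n ≤ a → F n = 0 := fun n hn =>
  Int.leInductionDown (motive := fun n _ => F n = 0) h
    (fun n hn ih => hs (n - 1) (by omega) (by rwa [sub_add_cancel])) n hn

theorem sub_coboundary (h : IsWittCocycle ψ) (φ : ℤ → K) :
    IsWittCocycle fun n m => ψ n m - ((m : K) - n) * (φ (n + m) - φ n - φ m) where
  skew n m := by rw [h.skew n m, add_comm n m]; ring
  cyclic n m k := by
    have := h.cyclic n m k
    rw [show m + k + n = n + m + k by ring, show k + n + m = n + m + k by ring]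
    push_cast
    linear_combination this

/-- The cocycle identity on `(n, m, 1)`; three of its six terms contain a value in column `1` and
drop out. -/
theorem rec_one (h : IsWittCocycle ψ) (h1 : ∀ n, ψ n 1 = 0) (n m : ℤ) :
    (1 - (n : K) - m) * ψ n m = (1 - (m : K)) * ψ n (m + 1) + (1 - (n : K)) * ψ (n + 1) m := by
  have := h.cyclic n m 1
  rw [h1, h1, h.skew 1 n, h1, add_comm 1 n, h.skew (m + 1) n] at this
  push_cast at this
  linear_combination this

variable [CharZero K]

theorem intCast_sub_ne_zero {n a : ℤ} (h : n ≠ a) : (n : K) - a ≠ 0 := by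
  rw [← Int.cast_sub, Int.cast_ne_zero]
  omega

theorem eq_zero_of_sub_mul {n a : ℤ} {x : K} (h : n ≠ a) (hx : ((n : K) - a) * x = 0) : x = 0 :=
  (mul_eq_zero.mp hx).resolve_left (intCast_sub_ne_zero h)

theorem self (h : IsWittCocycle ψ) (n : ℤ) : ψ n n = 0 := self_eq_neg.mp (h.skew n n)

variable (h : IsWittCocycle ψ) (h1 : ∀ n, ψ n 1 = 0) (h2 : ψ (-1) 2 = 0)
include h h1 h2

theorem col_zero (n : ℤ) : ψ n 0 = 0 := by
  have hs : ∀ n : ℤ, n ≠ 1 → ψ (n + 1) 0 = ψ n 0 := fun n hn => by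
    have := h.rec_one h1 n 0
    simp only [zero_add, h1] at this
    refine mul_left_cancel₀ (intCast_sub_ne_zero (K := K) hn) ?_
    push_cast at this ⊢
    linear_combination this
  -- The recurrence does not link `n = 1` to `n = 2`, so the range `n ≥ 2` needs its own starting
  -- value. It comes from the triple `(2, -1, 0)` and the normalization `ψ (-1) 2 = 0`.
  have hz : ψ 2 0 = 0 := by
    have h3 := h.cyclic 2 (-1) 0
    have h4 := h.skew 1 0
    have h5 := hs (-1) (by decide)
    rw [h1] at h4
    norm_num [h.self] at h3 h5
    rw [h.skew 2 (-1), h2, h.skew 1 0, h1, h.skew 0 2, h5] at h3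
    linear_combination (1 / 3) * h3 + (5 / 3) * h5
  rcases le_or_gt 2 n with hn | hn
  · exact eq_zero_of_le (F := fun n => ψ n 0) hz
      (fun n hn ih => (hs n (by omega)).trans ih) n hn
  · exact eq_zero_of_ge (F := fun n => ψ n 0) (a := 1) (by rw [h.skew, h1, neg_zero])
      (fun n hn ih => (hs n (by omega)).symm.trans ih) n (by omega)

/-- The recurrence in `n` breaks between `1` and `2`; the two normalizations supply one starting
value on each side. -/
theorem col_neg_one (n : ℤ) : ψ n (-1) = 0 := by
  have hs : ∀ n : ℤ, (2 - (n : K)) * ψ n (-1) = (1 - (n : K)) * ψ (n + 1) (-1) := fun n => by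
    have := h.rec_one h1 n (-1)
    rw [show (-1 : ℤ) + 1 = 0 by rfl, h.col_zero h1 h2] at this
    push_cast at this
    linear_combination this
  have up : ∀ n : ℤ, 2 ≤ n → ψ n (-1) = 0 :=
    eq_zero_of_le (F := fun n => ψ n (-1)) (by rw [h.skew, h2, neg_zero]) fun n hn ih => by
      have := hs n
      rw [ih] at this
      refine eq_zero_of_sub_mul (n := n) (a := 1) (by omega) ?_
      push_cast
      linear_combination this
  have down : ∀ n : ℤ, n ≤ 1 → ψ n (-1) = 0 :=
    eq_zero_of_ge (F := fun n => ψ n (-1)) (by rw [h.skew, h1, neg_zero]) fun n hn ih => by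
      have := hs n
      rw [ih] at this
      refine eq_zero_of_sub_mul (n := n) (a := 2) (by omega) ?_
      push_cast
      linear_combination -this
  rcases le_or_gt 2 n with hn | hn
  · exact up n hn
  · exact down n (by omega)

theorem rec_neg_one (n m : ℤ) :
    (1 + (n : K) + m) * ψ n m = (1 + (m : K)) * ψ n (m - 1) + (1 + (n : K)) * ψ (n - 1) m := by
  have := h.cyclic n m (-1)
  rw [h.col_neg_one h1 h2, h.col_neg_one h1 h2, h.skew (-1) n, h.col_neg_one h1 h2,
    show -1 + n = n - 1 by ring, ← sub_eq_add_neg m 1, h.skew (m - 1) n] at this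
  push_cast at this
  linear_combination -this

theorem col_two_of_pos (n : ℤ) (hn : 1 ≤ n) : ψ n 2 = 0 := by
  refine eq_zero_of_le (F := fun n => ψ n 2) (by rw [h.skew, h1, neg_zero]) (fun n hn ih => ?_) n hn
  have := h.rec_neg_one h1 h2 (n + 1) 2
  rw [add_sub_cancel_right, ih, show (2 : ℤ) - 1 = 1 by rfl, h1] at this
  refine eq_zero_of_sub_mul (n := n) (a := -4) (by omega) ?_
  push_cast at this ⊢
  linear_combination this

theorem col_neg_two_of_large (n : ℤ) (hn : 4 ≤ n) : ψ n (-2) = 0 := by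
  have hs : ∀ n : ℤ, (3 - (n : K)) * ψ n (-2) = (1 - (n : K)) * ψ (n + 1) (-2) := fun n => by
    have := h.rec_one h1 n (-2)
    rw [show (-2 : ℤ) + 1 = -1 by rfl, h.col_neg_one h1 h2] at this
    push_cast at this
    linear_combination this
  refine eq_zero_of_le (F := fun n => ψ n (-2)) ?_ (fun n hn ih => ?_) n hn
  -- At `n = 3` the left coefficient vanishes, so the starting value `ψ 4 (-2) = 0` needs no other
  -- input.
  · have := hs 3
    norm_num at this
    exact this
  · have := hs n
    rw [ih] at this
    refine eq_zero_of_sub_mul (n := n) (a := 1) (by omega) ?_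
    push_cast
    linear_combination this

theorem col_two (n : ℤ) : ψ n 2 = 0 := by
  rcases le_or_gt 1 n with hn | hn
  · exact h.col_two_of_pos h1 h2 n hn
  have hs : ∀ n : ℤ, ((n : K) + 4) * ψ (n + 1) 2 = ((n : K) + 2) * ψ n 2 := fun n => by
    have := h.rec_neg_one h1 h2 (n + 1) 2
    rw [show (2 : ℤ) - 1 = 1 by rfl, h1, add_sub_cancel_right] at this
    push_cast at this
    linear_combination this
  -- The downward recurrence has coefficient `n + 2` and says nothing at `n = -2`. In the triple
  -- `(6, -2, 2)` every other value is already known to vanish.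
  have hz : ψ (-2) 2 = 0 := by
    have h3 := h.cyclic 6 (-2) 2
    norm_num at h3
    rw [h.col_two_of_pos h1 h2 4 (by norm_num), h.col_neg_two_of_large h1 h2 6 (by norm_num),
      h.col_neg_two_of_large h1 h2 8 (by norm_num), h.skew 2 6,
      h.col_two_of_pos h1 h2 6 (by norm_num), h.skew 0 6, h.col_zero h1 h2] at h3
    linear_combination (1 / 6) * h3
  refine eq_zero_of_ge (F := fun n => ψ n 2) (a := 1) (by rw [h.skew, h1, neg_zero])
    (fun n hn ih => ?_) n (by omega)
  rcases eq_or_ne n (-2) with rfl | hn2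
  · exact hz
  · have := hs n
    rw [ih] at this
    refine eq_zero_of_sub_mul (n := n) (a := -2) hn2 ?_
    push_cast
    linear_combination -this

/-- Column `2` propagates upward by `rec_one` and column `-2` downward by `rec_neg_one`; columns
`-1`, `0`, `1` are already done. -/
theorem eq_zero (n m : ℤ) : ψ n m = 0 := by
  rcases le_or_gt 2 m with hm | hm
  · refine Int.leInduction (motive := fun m _ => ∀ n, ψ n m = 0) (h.col_two h1 h2)
      (fun m hm ih n => ?_) m hm n
    have := h.rec_one h1 n m
    rw [ih, ih] at this
    refine eq_zero_of_sub_mul (n := m) (a := 1) (by omega) ?_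
    push_cast
    linear_combination this
  · rcases eq_or_ne m 1 with rfl | hm1
    · exact h1 n
    rcases eq_or_ne m 0 with rfl | hm0
    · exact h.col_zero h1 h2 n
    have hc : ψ 2 (-2) = 0 := by rw [h.skew, h.col_two h1 h2, neg_zero]
    have h3 : ∀ n : ℤ, ψ n (-2) = 0 := fun n => by
      have hs : ∀ n : ℤ, (3 - (n : K)) * ψ n (-2) = (1 - (n : K)) * ψ (n + 1) (-2) := fun n => by
        have := h.rec_one h1 n (-2)
        rw [show (-2 : ℤ) + 1 = -1 by rfl, h.col_neg_one h1 h2] at this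
        push_cast at this
        linear_combination this
      rcases le_or_gt 4 n with hn | hn
      · exact h.col_neg_two_of_large h1 h2 n hn
      rcases eq_or_ne n 3 with rfl | hn3
      · have := hs 2
        norm_num [hc] at this
        exact this
      refine eq_zero_of_ge (F := fun n => ψ n (-2)) (a := 2) hc (fun n hn ih => ?_) n (by omega)
      have := hs n
      rw [ih] at this
      refine eq_zero_of_sub_mul (n := n) (a := 3) (by omega) ?_
      push_cast
      linear_combination -this
    rcases eq_or_ne m (-1) with rfl | hm1
    · exact h.col_neg_one h1 h2 n
    refine Int.leInductionDown (motive := fun m _ => ∀ n, ψ n m = 0) h3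
      (fun m hm ih n => ?_) m (show m ≤ -2 by omega) n
    have := h.rec_neg_one h1 h2 n m
    rw [ih, ih] at this
    refine eq_zero_of_sub_mul (n := m) (a := -1) (by omega) ?_
    push_cast
    linear_combination -this

omit h1 h2 in
/-- Cocycles of degree zero of the Witt algebra with values in the adjoint module are
coboundaries. -/
theorem exists_primitive : ∃ φ : ℤ → K, ∀ n m : ℤ, ψ n m = ((m : K) - n) * (φ (n + m) - φ n - φ m) := by
  obtain ⟨φ, hφ1, hφ⟩ := exists_discrete_primitive fun n : ℤ =>
    -- With `φ 1 = 0`, the increments for `n ≠ 1` are forced by killing `ψ n 1`. The increment at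
    -- `1` is `φ 2`, which remains free and is solved from `ψ (-1) 2 = 3 (φ 1 - φ (-1) - φ 2)`.
    if n = 1 then ψ (-1) 1 / 2 + ψ 0 1 - ψ (-1) 2 / 3 else ψ n 1 / (1 - (n : K))
  refine ⟨φ, fun n m => sub_eq_zero.mp ((h.sub_coboundary φ).eq_zero (fun n => ?_) ?_ n m)⟩
  · rw [hφ n, hφ1]
    split_ifs with hn
    · subst hn; simp [h.self]
    · have := intCast_sub_ne_zero (K := K) (Ne.symm hn)
      push_cast at this ⊢
      field_simp
      ring
  · have a0 := hφ (-1)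
    have a1 := hφ 0
    have a2 := hφ 1
    norm_num [hφ1] at a0 a1 a2
    norm_num [hφ1]
    linear_combination (-3) * a0 - 3 * a1 + 3 * a2

end IsWittCocycle

/-! ### Reduction of cocycles to degree zero -/

namespace IsAdjointCocycle

variable {K L : Type*} [Field K] [CharZero K] [LieRing L] [LieAlgebra K L]
  {ψ : L →ₗ[K] L →ₗ[K] L}

/-- If `b i₀` acts diagonally on the basis `b`, with integral eigenvalues `deg`, then every cocycle
is cohomologous to one of degree zero. -/
theorem exists_homogeneous {ι : Type*} (b : Module.Basis ι K L) (deg : ι → ℤ) (i₀ : ι)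
    (hdeg : ∀ i, ⁅b i₀, b i⁆ = (deg i : K) • b i) (h : IsAdjointCocycle ψ) :
    ∃ φ : L →ₗ[K] L, ∀ i j k, deg k ≠ deg i + deg j →
      b.repr ((ψ - adjointCoboundary φ) (b i) (b j)) k = 0 := by
  have hrepr : ∀ x k, b.repr ⁅b i₀, x⁆ k = (deg k : K) * b.repr x k := fun x k => by
    have : b.coord k ∘ₗ (LieAlgebra.ad K L (b i₀)) = (deg k : K) • b.coord k := by
      refine b.ext fun i => ?_
      simp only [LinearMap.comp_apply, LieAlgebra.ad_apply, hdeg, map_smul, LinearMap.smul_apply,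
        Module.Basis.coord_apply, Module.Basis.repr_self, smul_eq_mul]
      rcases eq_or_ne i k with rfl | hik
      · rfl
      · simp [Finsupp.single_eq_of_ne' hik]
    exact LinearMap.congr_fun this x
  -- The components of `ψ (b i₀) (b i)` of degree other than `deg i` are divided by the eigenvalue
  -- difference; where the degrees agree, the inverse of `0` is `0` and `φ` has no component.
  let φ : L →ₗ[K] L := b.constr K fun i => b.repr.symm <|
    Finsupp.onFinset (b.repr (ψ (b i₀) (b i))).support
      (fun k => b.repr (ψ (b i₀) (b i)) k * ((deg i : K) - deg k)⁻¹) fun k hk =>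
        Finsupp.mem_support_iff.mpr (left_ne_zero_of_mul hk)
  have hφ : ∀ i k, b.repr (φ (b i)) k =
      b.repr (ψ (b i₀) (b i)) k * ((deg i : K) - deg k)⁻¹ := fun i k => by
    simp [φ, Module.Basis.constr_basis]
  have hφ0 : φ (b i₀) = 0 := by
    refine b.repr.injective (Finsupp.ext fun k => ?_)
    simp [hφ, h.self]
  refine ⟨φ, ?_⟩
  set χ := ψ - adjointCoboundary φ with hχ
  have hc : IsAdjointCocycle χ := h.sub_coboundary φ
  have h0 : ∀ i k, deg k ≠ deg i → b.repr (χ (b i₀) (b i)) k = 0 := fun i k hk => by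
    have hne : (deg i : K) - deg k ≠ 0 := by
      rw [← Int.cast_sub, Int.cast_ne_zero]; omega
    simp only [hχ, LinearMap.sub_apply, adjointCoboundary_apply, hdeg, hφ0, zero_lie, sub_zero,
      map_sub, map_smul, Finsupp.sub_apply, Finsupp.smul_apply, hrepr, hφ, smul_eq_mul]
    field_simp
    ring
  have hcomm : ∀ x, χ (b i₀) ⁅b i₀, x⁆ = ⁅b i₀, χ (b i₀) x⁆ := fun x => by
    refine LinearMap.congr_fun (f := χ (b i₀) ∘ₗ LieAlgebra.ad K L (b i₀))
      (g := LieAlgebra.ad K L (b i₀) ∘ₗ χ (b i₀)) (b.ext fun i => ?_) x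
    simp only [LinearMap.comp_apply, LieAlgebra.ad_apply, hdeg, map_smul]
    refine b.repr.injective (Finsupp.ext fun k => ?_)
    rw [hrepr, map_smul, Finsupp.smul_apply, smul_eq_mul]
    by_cases hk : deg k = deg i
    · rw [hk]
    · rw [h0 i k hk, mul_zero, mul_zero]
  intro i j k hk
  have hcy := hc.cyclic (b i₀) (b i) (b j)
  -- `w` measures how far `χ (b i₀)` is from a derivation. As `χ (b i₀)` preserves degrees, `w` has
  -- degree `deg i + deg j`. By the cocycle identity, `ad (b i₀) - (deg i + deg j)` sends `χ (b i)
  -- (b j)` to `-w`, so the components of other degrees vanish.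
  set w := χ (b i₀) ⁅b i, b j⁆ - ⁅χ (b i₀) (b i), b j⁆ - ⁅b i, χ (b i₀) (b j)⁆ with hw
  have hww : ⁅b i₀, w⁆ = ((deg i : K) + deg j) • w := by
    have e1 := hcomm (b i)
    have e2 := hcomm (b j)
    rw [hdeg, map_smul] at e1 e2
    rw [hw, lie_sub, lie_sub, ← hcomm, leibniz_lie (b i₀) (b i) (b j),
      leibniz_lie (b i₀) (χ (b i₀) (b i)), leibniz_lie (b i₀) (b i), ← e1, ← e2, hdeg, hdeg]
    simp only [map_add, map_smul, smul_lie, lie_smul]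
    module
  have hz : ⁅b i₀, χ (b i) (b j)⁆ - ((deg i : K) + deg j) • χ (b i) (b j) = -w := by
    rw [hdeg, ← lie_skew (b j) (b i₀), hdeg, hc.skew ⁅b i, b j⁆, hc.skew (b j) (b i₀),
      ← lie_skew (χ (b i) (b j)), map_neg, map_smul, map_smul, LinearMap.neg_apply,
      LinearMap.smul_apply, LinearMap.smul_apply, hc.skew (b j) (b i), neg_lie,
      ← lie_skew (χ (b i₀) (b j))] at hcy
    rw [hw]
    linear_combination (norm := module) -hcy
  have hne : (deg k : K) - (deg i + deg j) ≠ 0 := by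
    rw [← Int.cast_add, ← Int.cast_sub, Int.cast_ne_zero]; omega
  have hwk := congrArg (fun x => b.repr x k) hww
  have hzk := congrArg (fun x => b.repr x k) hz
  simp only [hrepr, map_smul, map_sub, map_neg, Finsupp.smul_apply, Finsupp.sub_apply,
    Finsupp.neg_apply, smul_eq_mul] at hwk hzk
  have hwk0 : b.repr w k = 0 :=
    (mul_eq_zero.mp (show ((deg k : K) - (deg i + deg j)) * b.repr w k = 0 by
      linear_combination hwk)).resolve_left hne
  refine (mul_eq_zero.mp (show ((deg k : K) - (deg i + deg j)) * _ = 0 from ?_)).resolve_left hne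
  linear_combination hzk - hwk0

end IsAdjointCocycle

/-! ### Second cohomology of the Witt algebra -/

namespace WittAlgebra

variable {K : Type*} [Field K]

theorem basis_apply (n : ℤ) : basis K n = e n := rfl

theorem e_ne_zero (n : ℤ) : (e n : WittAlgebra K) ≠ 0 := (basis K).ne_zero n

theorem eq_smul_e {x : WittAlgebra K} {n : ℤ} (h : ∀ k, k ≠ n → (basis K).repr x k = 0) :
    x = (basis K).repr x n • e n := by
  refine (basis K).repr.injective (Finsupp.ext fun k => ?_)
  rw [map_smul, ← basis_apply, Module.Basis.repr_self, Finsupp.smul_apply]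
  rcases eq_or_ne k n with rfl | hk
  · simp
  · simp [h k hk, Finsupp.single_eq_of_ne hk]

variable [CharZero K]

theorem hasTrivialH2 : HasTrivialH2 K (WittAlgebra K) := by
  intro ψ hψ
  obtain ⟨φ₀, h₀⟩ := hψ.exists_homogeneous (basis K) id 0 fun n => by
    simp [basis_apply, e_lie_e]
  refine IsAdjointCocycle.exists_of_sub φ₀ ?_
  have hc := hψ.sub_coboundary φ₀
  generalize ψ - adjointCoboundary φ₀ = χ at h₀ hc
  let p : ℤ → ℤ → K := fun n m => (basis K).repr (χ (e n) (e m)) (n + m)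
  have hp : ∀ n m, χ (e n) (e m) = p n m • e (n + m) := fun n m => eq_smul_e fun k hk => h₀ n m k hk
  have hw : IsWittCocycle p := by
    refine ⟨fun n m => ?_, fun n m k => ?_⟩
    · simp only [p]
      rw [hc.skew (e n) (e m), add_comm, map_neg]
      rfl
    · have := hc.cyclic (e n) (e m) (e k)
      simp only [e_lie_e, map_smul, LinearMap.smul_apply, hp, smul_lie, smul_smul] at this
      rw [show m + k + n = n + m + k by ring, show k + n + m = n + m + k by ring] at this
      simp only [← add_smul] at this
      have := (smul_eq_zero.mp this).resolve_right (e_ne_zero _)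
      push_cast at this
      linear_combination this
  obtain ⟨f, hf⟩ := hw.exists_primitive
  refine ⟨(basis K).constr K fun n => f n • e n, (basis K).ext fun n => (basis K).ext fun m => ?_⟩
  have he : ∀ n, ((basis K).constr K fun n => f n • e n) (e n) = f n • (e n : WittAlgebra K) :=
    fun n => (basis K).constr_basis K _ n
  rw [adjointCoboundary_apply, basis_apply, basis_apply, hp, e_lie_e, map_smul, he, he, he,
    smul_lie, lie_smul, e_lie_e, hf]
  module

end WittAlgebra

/-! ### Second cohomology of the Virasoro algebra -/

namespace VirasoroAlgebra

variable {K : Type*} [Field K]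

/-- The basis of the Virasoro algebra formed by `t` and the `e n`. -/
noncomputable def basis (K : Type*) [Field K] : Module.Basis (Unit ⊕ ℤ) K (VirasoroAlgebra K) :=
  (Module.Basis.singleton Unit K).prod (WittAlgebra.basis K)

theorem basis_inl (u : Unit) : basis K (Sum.inl u) = t := by
  change ((Module.Basis.singleton Unit K).prod (WittAlgebra.basis K) (Sum.inl u) :
    K × WittAlgebra K) = (1, 0)
  ext1 <;> simp

theorem basis_inr (n : ℤ) : basis K (Sum.inr n) = e n := by
  change ((Module.Basis.singleton Unit K).prod (WittAlgebra.basis K) (Sum.inr n) :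
    K × WittAlgebra K) = (0, WittAlgebra.basis K n)
  ext1 <;> simp

theorem smul_e_add_smul_t_eq_zero {a c : K} {n : ℤ} (h : a • e n + c • t = (0 : VirasoroAlgebra K)) :
    a = 0 ∧ c = 0 := by
  have h1 : a * 0 + c * 1 = 0 := congrArg Prod.fst h
  have h2 : a • WittAlgebra.e n + c • (0 : WittAlgebra K) = 0 := congrArg Prod.snd h
  rw [smul_zero, add_zero] at h2
  exact ⟨(smul_eq_zero.mp h2).resolve_right (WittAlgebra.e_ne_zero n), by simpa using h1⟩

/-- The central element has degree zero, so it can occur only when `n = 0`. -/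
theorem exists_eq_smul_e_add_smul_t {x : VirasoroAlgebra K} {n : ℤ}
    (h : ∀ k, Sum.elim (fun _ => 0) id k ≠ n → (basis K).repr x k = 0) :
    ∃ a c : K, x = a • e n + c • t ∧ (n ≠ 0 → c = 0) := by
  refine ⟨(WittAlgebra.basis K).repr x.2 n, x.1, Prod.ext ?_ ?_, fun hn => ?_⟩
  · change x.1 = (WittAlgebra.basis K).repr x.2 n * 0 + x.1 * 1
    ring
  · change x.2 = (WittAlgebra.basis K).repr x.2 n • WittAlgebra.e n + x.1 • (0 : WittAlgebra K)
    rw [smul_zero, add_zero]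
    exact WittAlgebra.eq_smul_e fun k hk => h (Sum.inr k) hk
  · refine Eq.trans ?_ (h (Sum.inl ()) hn.symm)
    have key : ∀ y : K × WittAlgebra K, y.1 =
        ((Module.Basis.singleton Unit K).prod (WittAlgebra.basis K)).repr y (Sum.inl ()) := by
      simp
    exact key x

/-- The linear endomorphism with `t ↦ v` and `e n ↦ f n`. -/
noncomputable def lift (f : ℤ → VirasoroAlgebra K) (v : VirasoroAlgebra K) :
    VirasoroAlgebra K →ₗ[K] VirasoroAlgebra K :=
  (basis K).constr K (Sum.elim f (fun _ => v) ∘ Sum.swap)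

@[simp] theorem lift_e (f : ℤ → VirasoroAlgebra K) (v : VirasoroAlgebra K) (n : ℤ) :
    lift f v (e n) = f n := by
  rw [← basis_inr, lift, Module.Basis.constr_basis]; rfl

@[simp] theorem lift_t (f : ℤ → VirasoroAlgebra K) (v : VirasoroAlgebra K) :
    lift f v t = v := by
  rw [← basis_inl (), lift, Module.Basis.constr_basis]; rfl

/-- The structure constants of the central term. -/
def centralTerm (K : Type*) [Field K] (n m : ℤ) : K :=
  1 / 12 * ((n : K) ^ 3 - (n : K)) * (if n = -m then 1 else 0)

theorem centralTerm_of_ne {n m : ℤ} (h : n + m ≠ 0) : centralTerm K n m = 0 := by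
  rw [centralTerm, if_neg (by omega), mul_zero]

theorem centralTerm_neg (n : ℤ) : centralTerm K n (-n) = 1 / 12 * ((n : K) ^ 3 - (n : K)) := by
  rw [centralTerm, if_pos (by omega), mul_one]

/-- An additive function on `ℤ`, where additivity is only required on pairs of distinct integers,
is linear. -/
theorem eq_intCast_mul_of_add {τ : ℤ → K} (h : ∀ n m : ℤ, n ≠ m → τ (n + m) = τ n + τ m) (n : ℤ) :
    τ n = n * τ 1 := by
  have h0 : τ 0 = 0 := by simpa using h 1 0 (by norm_num)
  have h1 : τ (-1) = -τ 1 := by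
    have := h 1 (-1) (by norm_num)
    norm_num [h0] at this
    linear_combination -this
  -- The pair `(1, 1)` is excluded, so `τ 2` is reached through `2 + (-1) = 1`.
  have h2 : τ 2 = 2 * τ 1 := by
    have := h 2 (-1) (by norm_num)
    norm_num [h1] at this
    linear_combination -this
  have hs : ∀ n, τ (n + 1) = τ n + τ 1 := fun n => by
    rcases eq_or_ne n 1 with rfl | hn
    · change τ 2 = _
      linear_combination h2
    · exact h n 1 hn
  induction n using Int.induction_on with
  | zero => simp [h0]
  | succ n ih => rw [hs, ih]; push_cast; ring
  | pred n ih =>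
    have := hs (-n - 1)
    rw [sub_add_cancel, ih] at this
    push_cast at this ⊢
    linear_combination -this

variable [CharZero K]

theorem t_lie (x : VirasoroAlgebra K) : ⁅(t : VirasoroAlgebra K), x⁆ = 0 := by
  rw [← lie_skew, lie_t, neg_zero]

theorem e_lie_e' (n m : ℤ) : ⁅(e n : VirasoroAlgebra K), (e m : VirasoroAlgebra K)⁆ =
    ((m : K) - (n : K)) • e (n + m) - centralTerm K n m • t := e_lie_e n m

theorem cocycle_eq_zero {ψ : VirasoroAlgebra K →ₗ[K] VirasoroAlgebra K →ₗ[K] VirasoroAlgebra K}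
    (h : IsAdjointCocycle ψ) (hee : ∀ n m, ψ (e n) (e m) = 0) (het : ∀ n, ψ (e n) t = 0) : ψ = 0 := by
  refine (basis K).ext fun i => (basis K).ext fun j => ?_
  rcases i with i | i <;> rcases j with j | j <;>
    simp only [basis_inl, basis_inr, hee, het, h.self, h.skew t (e _), neg_zero, LinearMap.zero_apply]

/-- The scalar cocycles of degree zero of the Witt algebra: `σ n` is the value on
`(e n, e (-n))`. -/
theorem eq_cubic_of_cocycle {σ : ℤ → K} (hodd : ∀ n, σ (-n) = -σ n)
    (h : ∀ n m : ℤ, ((m : K) - n) * σ (n + m) + (2 * m + n) * σ n - (2 * n + m) * σ m = 0) :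
    ∃ a c : K, ∀ n, σ n = a * n + c * ((n : K) ^ 3 - n) := by
  -- The cubic `n ^ 3 - n` is `0` at `1` and `6` at `2`. The recurrence with `m = 1` determines `σ
  -- (n + 1)` except at `n = 1`, so `σ 1` and `σ 2` are the free values.
  refine ⟨σ 1, σ 2 / 6 - σ 1 / 3, fun n => ?_⟩
  have hpos : ∀ n : ℤ, 2 ≤ n → σ n = σ 1 * n + (σ 2 / 6 - σ 1 / 3) * ((n : K) ^ 3 - n) :=
    fun n hn => Int.leInduction
      (motive := fun n _ => σ n = σ 1 * n + (σ 2 / 6 - σ 1 / 3) * ((n : K) ^ 3 - n))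
      (by push_cast; ring)
      (fun n hn ih => by
        have h1 := h n 1
        rw [ih] at h1
        have hne : (n : K) - (1 : ℤ) ≠ 0 := IsWittCocycle.intCast_sub_ne_zero (by omega)
        refine mul_left_cancel₀ hne ?_
        push_cast at h1 ⊢
        linear_combination -h1) n hn
  have h0 : σ 0 = 0 := self_eq_neg.mp (by simpa using hodd 0)
  have hnn : ∀ n : ℤ, 0 ≤ n → σ n = σ 1 * n + (σ 2 / 6 - σ 1 / 3) * ((n : K) ^ 3 - n) :=
    fun n hn => by
      obtain rfl | rfl | hn : n = 0 ∨ n = 1 ∨ 2 ≤ n := by omega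
      · simp [h0]
      · simp
      · exact hpos n hn
  rcases le_total 0 n with hn | hn
  · exact hnn n hn
  · have := hnn (-n) (by omega)
    rw [hodd] at this
    push_cast at this
    linear_combination -this

section CocycleReduction

variable {ψ : VirasoroAlgebra K →ₗ[K] VirasoroAlgebra K →ₗ[K] VirasoroAlgebra K}
  (h : IsAdjointCocycle ψ)

include h

/-- A cocycle with values in the centre on the `e n` and vanishing on `t` is a coboundary. -/
theorem exists_primitive_of_scalar (het : ∀ n, ψ (e n) t = 0) {q : ℤ → ℤ → K}
    (hq : ∀ n m, ψ (e n) (e m) = q n m • t) (hq0 : ∀ n m, n + m ≠ 0 → q n m = 0) :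
    ∃ φ, ψ = adjointCoboundary φ := by
  have ht : ∀ {a : K}, a • (t : VirasoroAlgebra K) = 0 → a = 0 := fun {a} ha =>
    (smul_e_add_smul_t_eq_zero (a := 0) (n := 0) (by rw [zero_smul, zero_add, ha])).2
  have hskew : ∀ n m, q n m = -q m n := fun n m => by
    refine sub_eq_zero.mp (ht ?_)
    rw [sub_smul, neg_smul, ← hq, ← hq, h.skew, sub_self]
  obtain ⟨a, c, hac⟩ := eq_cubic_of_cocycle (σ := fun n => q n (-n))
    (fun n => by rw [neg_neg]; exact hskew _ _)
    (fun n m => by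
      have hcy := h.cyclic (e n) (e m) (e (-(n + m)))
      have htl : ∀ n, ψ t (e n) = 0 := fun n => by rw [h.skew, het, neg_zero]
      simp only [e_lie_e', map_sub, map_smul, LinearMap.sub_apply, LinearMap.smul_apply, hq, htl,
        smul_lie, t_lie, smul_zero, sub_zero, add_zero] at hcy
      simp only [smul_smul, ← add_smul] at hcy
      have hcy := ht hcy
      rw [show m + -(n + m) = -n by ring, show -(n + m) + n = -m by ring, hskew (-n) n,
        hskew (-m) m] at hcy
      push_cast at hcy
      linear_combination hcy)
  -- All values on the `e k` are central, so the coboundary is the cochain applied to `[e n, e m]`.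
  -- On `(e n, e (-n))`, the part `-2n • e 0` yields `a n` and the central part yields `c (n ^ 3 -
  -- n)`.
  refine ⟨lift (fun n => if n = 0 then (-a / 2) • t else 0) ((-12 * c) • t),
    sub_eq_zero.mp (cocycle_eq_zero (h.sub_coboundary _) (fun n m => ?_) fun n => ?_)⟩
  · have hl : ∀ k : ℤ, ∀ x : VirasoroAlgebra K,
        ⁅(if k = 0 then (-a / 2) • t else 0 : VirasoroAlgebra K), x⁆ = 0 := fun k x => by
      split_ifs <;> simp [t_lie]
    simp only [LinearMap.sub_apply, adjointCoboundary_apply, hq, e_lie_e', map_sub, map_smul,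
      lift_e, lift_t]
    rw [hl, ← lie_skew (e n), hl]
    by_cases hnm : n + m = 0
    · obtain rfl : m = -n := by omega
      have := hac n
      rw [this, centralTerm_neg, if_pos hnm]
      push_cast
      module
    · rw [hq0 n m hnm, if_neg hnm, centralTerm_of_ne hnm]
      simp
  · simp [adjointCoboundary_apply, het, lie_t]

/-- A cocycle of degree zero vanishing on `t` is a coboundary. -/
theorem exists_primitive_of_homogeneous (het : ∀ n, ψ (e n) t = 0) {p q : ℤ → ℤ → K}
    (hpq : ∀ n m, ψ (e n) (e m) = p n m • e (n + m) + q n m • t)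
    (hq0 : ∀ n m, n + m ≠ 0 → q n m = 0) : ∃ φ, ψ = adjointCoboundary φ := by
  have hw : IsWittCocycle p := by
    refine ⟨fun n m => ?_, fun n m k => ?_⟩
    · have h1 := h.skew (e n) (e m)
      rw [hpq, hpq, add_comm m n] at h1
      refine eq_neg_of_add_eq_zero_left
        (smul_e_add_smul_t_eq_zero (n := n + m) (c := q n m + q m n) ?_).1
      linear_combination (norm := module) h1
    · have hcy := h.cyclic (e n) (e m) (e k)
      have htl : ∀ n, ψ t (e n) = 0 := fun n => by rw [h.skew, het, neg_zero]
      simp only [e_lie_e', map_sub, map_smul, LinearMap.sub_apply, LinearMap.smul_apply, hpq, htl,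
        smul_lie, add_lie, t_lie, smul_zero, sub_zero, add_zero] at hcy
      rw [show m + k + n = n + m + k by ring, show k + n + m = n + m + k by ring] at hcy
      refine (smul_e_add_smul_t_eq_zero (n := n + m + k)
        (c := ((m : K) - n) * q (n + m) k - p n m * centralTerm K (n + m) k +
          (((k : K) - m) * q (m + k) n - p m k * centralTerm K (m + k) n) +
          (((n : K) - k) * q (k + n) m - p k n * centralTerm K (k + n) m)) ?_).1
      push_cast at hcy
      linear_combination (norm := module) hcy
  obtain ⟨f, hf⟩ := hw.exists_primitive
  -- This removes the `e`-components; the brackets with `f n • e n` and `f m • e m` shift `q` by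
  -- central terms.
  refine IsAdjointCocycle.exists_of_sub (lift (fun n => f n • e n) 0) ?_
  refine exists_primitive_of_scalar (h.sub_coboundary _)
    (q := fun n m => q n m - (f n + f m) * centralTerm K n m) (fun n => ?_) (fun n m => ?_)
    fun n m hnm => ?_
  · simp [adjointCoboundary_apply, het, lie_t]
  · simp only [LinearMap.sub_apply, adjointCoboundary_apply, hpq, e_lie_e', map_sub, map_smul,
      lift_e, lift_t, smul_lie, lie_smul, hf]
    module
  · simp only [hq0 n m hnm, centralTerm_of_ne hnm, mul_zero, sub_zero]

end CocycleReduction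

theorem hasTrivialH2 : HasTrivialH2 K (VirasoroAlgebra K) := by
  intro ψ hψ
  obtain ⟨φ₀, h₀⟩ := hψ.exists_homogeneous (basis K) (Sum.elim (fun _ => 0) id) (Sum.inr 0) <| by
    rintro (u | n)
    · simp [basis_inl, lie_t]
    · simp [basis_inr, e_lie_e]
  refine IsAdjointCocycle.exists_of_sub φ₀ ?_
  have hc := hψ.sub_coboundary φ₀
  generalize ψ - adjointCoboundary φ₀ = χ at h₀ hc
  have hee : ∀ n m, ∃ p q : K, χ (e n) (e m) = p • e (n + m) + q • t ∧ (n + m ≠ 0 → q = 0) :=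
    fun n m => exists_eq_smul_e_add_smul_t fun k hk => by
      simpa [basis_inr] using h₀ (Sum.inr n) (Sum.inr m) k (by simpa using hk)
  have het : ∀ n, ∃ p q : K, χ (e n) t = p • e n + q • t ∧ (n ≠ 0 → q = 0) :=
    fun n => exists_eq_smul_e_add_smul_t fun k hk => by
      simpa [basis_inr, basis_inl] using h₀ (Sum.inr n) (Sum.inl ()) k (by simpa using hk)
  choose p q hpq hq0 using hee
  choose τ κ hτ hκ0 using het
  -- By the cocycle identity on `(e n, e m, t)`, the map `x ↦ χ x t` is a derivation. The two
  -- equations are its `e`- and `t`-components.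
  have hder : ∀ n m : ℤ, ((m : K) - n) * (τ (n + m) - τ n - τ m) = 0 ∧
      ((m : K) - n) * κ (n + m) - τ m * centralTerm K m n + τ n * centralTerm K n m = 0 :=
    fun n m => by
      have hcy := hc.cyclic (e n) (e m) t
      rw [lie_t, t_lie, lie_t, hc.skew t (e n)] at hcy
      simp only [e_lie_e', map_sub, map_smul, LinearMap.sub_apply, LinearMap.smul_apply, hτ,
        smul_lie, add_lie, neg_lie, t_lie, smul_zero, sub_zero, add_zero, hc.self, map_zero,
        LinearMap.zero_apply, add_comm m n] at hcy
      refine smul_e_add_smul_t_eq_zero (n := n + m) ?_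
      linear_combination (norm := module) hcy
  have hτ1 : ∀ n : ℤ, τ n = n * τ 1 := eq_intCast_mul_of_add fun n m hnm => by
    have := IsWittCocycle.eq_zero_of_sub_mul (n := m) (a := n) (Ne.symm hnm) (hder n m).1
    linear_combination this
  have hκ : ∀ n, κ n = 0 := fun n => by
    rcases eq_or_ne n 0 with rfl | hn
    -- The central term vanishes on `e 1` and `e (-1)`, leaving `-2 κ 0 = 0`.
    · have := (hder 1 (-1)).2
      norm_num [centralTerm] at this
      exact this
    · exact hκ0 n hn
  -- The cochain `t ↦ τ 1 • e 0` has coboundary `-τ 1 • [e n, e 0] = n τ 1 • e n` on `(e n, t)`,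
  -- which is exactly `χ (e n) t`.
  refine IsAdjointCocycle.exists_of_sub (lift 0 (τ 1 • e 0)) ?_
  refine exists_primitive_of_homogeneous (hc.sub_coboundary _)
    (p := fun n m => p n m + centralTerm K n m * τ 1) (q := q) (fun n => ?_) (fun n m => ?_) hq0
  · rw [LinearMap.sub_apply, LinearMap.sub_apply, adjointCoboundary_apply, lie_t, hτ, hκ, hτ1,
      map_zero, lie_t, lift_t, lie_smul, e_lie_e', add_zero]
    have h0 : centralTerm K n 0 = 0 := by
      rcases eq_or_ne n 0 with rfl | hn
      · simp [centralTerm]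
      · exact centralTerm_of_ne (by simpa using hn)
    rw [h0]
    push_cast
    module
  · rw [LinearMap.sub_apply, LinearMap.sub_apply, adjointCoboundary_apply, hpq, e_lie_e']
    simp only [map_sub, map_smul, lift_e, lift_t, Pi.zero_apply, lie_zero, zero_lie, smul_zero]
    by_cases hnm : n + m = 0
    · rw [hnm]
      module
    · rw [centralTerm_of_ne hnm]
      module

end VirasoroAlgebra

theorem corollary1 (K : Type*) [Field K] [CharZero K] :
    (IsInfinitesimallyRigid K (WittAlgebra K) ∧ IsFormallyRigid K (WittAlgebra K)) ∧
      (IsInfinitesimallyRigid K (VirasoroAlgebra K) ∧ IsFormallyRigid K (VirasoroAlgebra K)) :=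
  ⟨⟨WittAlgebra.hasTrivialH2.isInfinitesimallyRigid, WittAlgebra.hasTrivialH2.isFormallyRigid⟩,
    VirasoroAlgebra.hasTrivialH2.isInfinitesimallyRigid,
    VirasoroAlgebra.hasTrivialH2.isFormallyRigid⟩
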